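/- Let $p$ be a prime with $p\equiv 1\pmod 4$, let $n_1$ be a positive integer coprime to $p$, let $m$ be the least positive integer with $p^m\equiv 1\pmod{n_1}$, and put $q=p^m$, $N=(q-1)/n_1$, $N_1=\gcd\bigl(N,\frac{q-1}{p-1}\bigr)$. Let $\alpha$ be a primitive element of $\mathbb F_q$, $\theta=\alpha^N$, let $\mathrm{Tr}$ be the trace from $\mathbb F_q$ to $\mathbb F_p$, and let $$C_D=\{(\mathrm{Tr}(a\theta^0),\mathrm{Tr}(a\theta^1),\dots,\mathrm{Tr}(a\theta^{n_1-1})) : a\in\mathbb F_q\}\subseteq\mathbb F_p^{n_1}$$ be the linear code with defining set $D=\{\theta^i:0\le i<n_1\}$. For $1\le r\le\dim C_D$ let $d_r(C_D)=\min\{|\mathrm{Supp}(U)| : U\subseteq C_D \text{ a subspace},\ \dim U=r\}$ be the $r$-th generalized Hamming weight, where $\mathrm{Supp}(U)$ is the set of coordinates at which some vector of $U$ is nonzero. Assume $N_1=4$. Then there are integers $u_1,v_1$ with $$p^{m/2}=u_1^2+4v_1^2,\qquad u_1\equiv 1\pmod 4,\qquad \gcd(u_1,p)=1,$$ and for all such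 $u_1,v_1$ and every integer $r$ with $1\le r\le m/4$, one has $r\le\dim C_D$ and $$d_r(C_D)=\Bigl(1-\frac1{p^r}\Bigr)\frac{q-\sqrt q-4q^{1/4}|v_1|}{N}.$$ (The assumptions force $4\mid m$.) -/

import Mathlib

/-- The support of a subspace `U` of `K^ι`: the coordinates at which some vector of `U` is
nonzero. -/
def codeSupport {K ι : Type*} [Field K] (U : Submodule K (ι → K)) : Set ι :=
  {i | ∃ x ∈ U, x i ≠ 0}

/-- The `r`-th generalized Hamming weight of a linear code `C`: the least support size of an
`r`-dimensional subspace of `C`. It is meaningful for `r ≤ dim C`, see `isLeast_ghw`. -/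
noncomputable def ghw {K ι : Type*} [Field K] (C : Submodule K (ι → K)) (r : ℕ) : ℕ :=
  sInf {w : ℕ | ∃ U : Submodule K (ι → K),
    U ≤ C ∧ Module.finrank K U = r ∧ w = (codeSupport U).ncard}

/-- For `r ≤ dim C` the generalized Hamming weight is an attained minimum. -/
theorem isLeast_ghw {K ι : Type*} [Field K] (C : Submodule K (ι → K)) (r : ℕ)
    (hr : r ≤ Module.finrank K C) :
    IsLeast {w : ℕ | ∃ U : Submodule K (ι → K),
      U ≤ C ∧ Module.finrank K U = r ∧ w = (codeSupport U).ncard} (ghw C r) := by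
  refine ⟨Nat.sInf_mem ?_, fun w hw => Nat.sInf_le hw⟩
  obtain ⟨f, hf⟩ := exists_linearIndependent_of_le_finrank hr
  have hV : Module.finrank K (Submodule.span K (Set.range f)) = r := by
    simpa using finrank_span_eq_card hf
  exact ⟨_, (Submodule.span K (Set.range f)).map C.subtype, Submodule.map_subtype_le C _,
    (LinearEquiv.finrank_eq (Submodule.equivSubtypeMap C _)).symm.trans hV, rfl⟩

/-- The code `{(Tr(a d_i))_i : a ∈ F}` over the prime field `ZMod p`, for a defining family
`d : ι → F` of elements of `F`. -/
noncomputable def traceCode (p : ℕ) [Fact p.Prime] {F ι : Type*} [Field F] [Algebra (ZMod p) F]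
    (d : ι → F) : Submodule (ZMod p) (ι → ZMod p) :=
  LinearMap.range (LinearMap.pi fun i =>
    (Algebra.trace (ZMod p) F).comp (LinearMap.mulRight (ZMod p) (d i)))

/-- `x` is a codeword iff it is `(Tr(a d_i))_i` for some `a`. -/
theorem mem_traceCode (p : ℕ) [Fact p.Prime] {F ι : Type*} [Field F] [Algebra (ZMod p) F]
    (d : ι → F) (x : ι → ZMod p) :
    x ∈ traceCode p d ↔ ∃ a : F, (fun i => Algebra.trace (ZMod p) F (a * d i)) = x :=
  Iff.rfl

/-- The representations `p^(m/2) = u² + 4v²` with `u ≡ 1 (mod 4)` and `gcd(u, p) = 1`. -/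
def IsQuarticRep (p m : ℕ) (u v : ℤ) : Prop :=
  (p : ℤ) ^ (m / 2) = u ^ 2 + 4 * v ^ 2 ∧ u ≡ 1 [ZMOD 4] ∧ IsCoprime u (p : ℤ)

/-! Put `k = m/4`, `P = p^k`, and let `S(a)` be the sum of `ψ(a x⁴)` over `x` in `F`, with `ψ` the
canonical additive character (`quarticSum`). Subcodes correspond to subspaces `H` of `F`. Whether a
trace vanishes is unaffected by scaling by `𝔽_p^×`, which contains all nonzero `(q-1)/(p-1)`-th
powers; since `N₁ = 4`, averages over `N`-th powers are averages over fourth powers. Orthogonality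
on `H` then gives `N p^r |Supp| = ∑ (q - S(a))` over nonzero `a ∈ H` (`card_trace_ne_zero_eq_sum`).
An upper bound for `S` thus bounds the weight below, with equality when `S` is maximal on all of `H
\ {0}`. If `S(a)` is maximal, `a` times a subspace of the subfield of order `p^k` is such an `H`,
because nonzero elements of that subfield are fourth powers; this is where `r ≤ m/4` enters.

To find the maximum, expand `S` in Gauss sums of a quartic character `χ`. As `χ` is trivial on
`𝔽_p^×`, its Gauss sum `G` lies in `ℤ[i]`. From `G² = ±P² J(χ, χ)` and `p ∤ J(χ, χ)`
(`not_dvd_jacobiSum_quartic`) one gets `G = P w` with `w` of norm `P²` and `p ∤ w`. The coordinates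
of `w` give the four values of `S`, and `S(1) ≡ 1 (mod 4)` decides which coordinate is even. The
maximum is `P² + 4P|v|`, where `|v|` is the same for every admissible representation of `P²`. -/

/-! ### Arithmetic of prime powers: sums of two squares, a binomial coefficient, power sums. -/

/-- `p^j` divides `(ac - bd)(ac + bd)`, and `p` cannot divide both factors since `p ∤ 2ac`, so `p^j`
divides one of them. That factor is odd, hence nonzero, and so uses up all of `p^(2j) = (ac ∓ bd)² +
(ad ± bc)²`; the second square vanishes. -/
theorem sq_eq_sq_of_sum_two_sq_eq_prime_pow {p : ℕ} (hp : p.Prime) (hp2 : p ≠ 2) {j : ℕ}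
    {a b c d : ℤ} (h₁ : (p : ℤ) ^ j = a ^ 2 + b ^ 2) (h₂ : (p : ℤ) ^ j = c ^ 2 + d ^ 2)
    (hpa : ¬ (p : ℤ) ∣ a) (hpc : ¬ (p : ℤ) ∣ c) (ha : Odd a) (hb : Even b) (hc : Odd c)
    (hd : Even d) : b ^ 2 = d ^ 2 := by
  have hpZ : Prime (p : ℤ) := Nat.prime_iff_prime_int.mp hp
  have hp2' : ¬ (p : ℤ) ∣ 2 := by
    intro h
    have : p ∣ 2 := by exact_mod_cast h
    exact hp2 ((Nat.prime_dvd_prime_iff_eq hp Nat.prime_two).mp this)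
  have hpos : (0 : ℤ) < (p : ℤ) ^ j := pow_pos (by exact_mod_cast hp.pos) _
  have key : ∀ d : ℤ, (p : ℤ) ^ j = c ^ 2 + d ^ 2 → Even d → (p : ℤ) ^ j ∣ a * c - b * d →
      b ^ 2 = d ^ 2 := by
    intro d h₂ hd hdvd
    obtain ⟨t, ht⟩ := hdvd
    have h3 : ((p : ℤ) ^ j) ^ 2 = (a * c - b * d) ^ 2 + (a * d + b * c) ^ 2 := by
      linear_combination ((p : ℤ) ^ j) * h₁ + (a ^ 2 + b ^ 2) * h₂
    have ht0 : t ≠ 0 := by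
      rintro rfl
      have h4 : Odd (a * c) := ha.mul hc
      have h5 : a * c = b * d := by linarith
      rw [h5] at h4
      exact (Int.not_odd_iff_even.mpr (hb.mul_right d)) h4
    have h6 : a * d + b * c = 0 := by
      have h7 : (1 : ℤ) ≤ t ^ 2 := by have := sq_pos_of_ne_zero ht0; omega
      rw [ht, mul_pow] at h3
      have h8 : 0 ≤ ((p : ℤ) ^ j) ^ 2 := sq_nonneg _
      have h9 : (a * d + b * c) ^ 2 ≤ 0 := by nlinarith
      exact pow_eq_zero_iff (two_ne_zero) |>.mp (le_antisymm h9 (sq_nonneg _))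
    have h10 : a ^ 2 * d ^ 2 = b ^ 2 * c ^ 2 := by
      linear_combination (a * d - b * c) * h6
    have h11 : (p : ℤ) ^ j * (b ^ 2 - d ^ 2) = 0 := by
      linear_combination b ^ 2 * h₂ - d ^ 2 * h₁ - h10
    rcases mul_eq_zero.mp h11 with h | h
    · exact absurd h hpos.ne'
    · linarith
  have hprod : (p : ℤ) ^ j ∣ (a * c - b * d) * (a * c + b * d) :=
    ⟨a ^ 2 - d ^ 2, by linear_combination - a ^ 2 * h₂ + d ^ 2 * h₁⟩
  by_cases hdiv : (p : ℤ) ∣ a * c - b * d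
  · have h4 : ¬ (p : ℤ) ∣ a * c + b * d := by
      intro h
      have h5 : (p : ℤ) ∣ 2 * (a * c) := by
        have := dvd_add hdiv h
        rwa [show a * c - b * d + (a * c + b * d) = 2 * (a * c) by ring] at this
      rcases hpZ.dvd_or_dvd h5 with h | h
      · exact hp2' h
      · rcases hpZ.dvd_or_dvd h with h | h
        · exact hpa h
        · exact hpc h
    have h5 := (((Prime.coprime_iff_not_dvd hpZ).mpr h4).pow_left (m := j)).dvd_of_dvd_mul_right hprod
    exact key d h₂ hd h5
  · have h5 := (((Prime.coprime_iff_not_dvd hpZ).mpr hdiv).pow_left (m := j)).dvd_of_dvd_mul_left hprod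
    have := key (-d) (by rw [h₂]; ring) hd.neg (by rwa [mul_neg, sub_neg_eq_add])
    rwa [neg_sq] at this

/-- The digits of `(p ^ m - 1) / 4` in base `p` are all `(p - 1) / 4`. -/
theorem not_dvd_choose_quarter {p : ℕ} (hp : p.Prime) (hp4 : p % 4 = 1) (m e : ℕ)
    (he : 4 * e + 1 = p ^ m) : ¬ p ∣ (3 * e).choose e := by
  have : Fact p.Prime := ⟨hp⟩
  induction m generalizing e with
  | zero =>
    obtain rfl : e = 0 := by simpa using he
    simpa using hp.one_lt.ne'
  | succ m ih =>
    have h1 : p ^ m % 4 = 1 := by rw [Nat.pow_mod, hp4]; simp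
    obtain ⟨e', he'⟩ : ∃ e', 4 * e' + 1 = p ^ m := ⟨p ^ m / 4, by omega⟩
    obtain ⟨f, hf⟩ : ∃ f, p = 4 * f + 1 := ⟨p / 4, by omega⟩
    have hee : e = f + p * e' := by
      have : 4 * e + 1 = (4 * e' + 1) * p := by rw [he, he', pow_succ]
      nlinarith
    -- Lucas: as `3f < p`, tripling `e` creates no carry, so the lowest digits of `3e` and `e` are
    -- `3f` and `f`.
    have hmod := Choose.choose_modEq_choose_mod_mul_choose_div_nat (p := p) (n := 3 * e) (k := e)
    have h3 : 3 * e = 3 * f + p * (3 * e') := by rw [hee]; ring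
    rw [h3, hee, Nat.add_mul_mod_self_left, Nat.add_mul_mod_self_left,
      Nat.add_mul_div_left _ _ hp.pos, Nat.add_mul_div_left _ _ hp.pos,
      Nat.mod_eq_of_lt (show 3 * f < p by omega), Nat.mod_eq_of_lt (show f < p by omega),
      Nat.div_eq_of_lt (show 3 * f < p by omega), Nat.div_eq_of_lt (show f < p by omega),
      zero_add, zero_add] at hmod
    rw [h3, hee, hmod.dvd_iff dvd_rfl, hp.dvd_mul, not_or]
    refine ⟨fun h => ?_, ih e' he'⟩
    have h4 : p ∣ (3 * f).factorial := h.trans ⟨f.factorial * (3 * f - f).factorial, by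
      rw [← Nat.choose_mul_factorial_mul_factorial (show f ≤ 3 * f by omega)]; ring⟩
    have := (hp.dvd_factorial).mp h4
    omega

/-- The power sum over a finite field. -/
theorem FiniteField.sum_pow_eq_ite (K : Type*) [Field K] [Fintype K] {i : ℕ} (hi : i ≠ 0) :
    ∑ x : K, x ^ i = if Fintype.card K - 1 ∣ i then -1 else 0 := by
  classical
  rw [← FiniteField.sum_pow_units, ← Fintype.sum_subtype_add_sum_subtype (fun x : K => x ≠ 0),
    show ∑ x : {x : K // ¬ x ≠ 0}, (x : K) ^ i = 0 from
      Finset.sum_eq_zero fun x _ => by rw [not_not.mp x.2, zero_pow hi], add_zero]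
  exact (Fintype.sum_equiv unitsEquivNeZero _ _ fun x => rfl).symm

/-- After binomial expansion only exponents divisible by `q - 1 = 4e` survive summation; among `3e,
…, 6e` that is `4e` alone. The sum is the reduction of a quartic Jacobi sum modulo a prime above
`p`. -/
theorem FiniteField.sum_pow_mul_one_sub_pow (K : Type*) [Field K] [Fintype K] {e : ℕ}
    (he : 4 * e + 1 = Fintype.card K) (he0 : 0 < e) :
    ∑ x : K, x ^ (3 * e) * (1 - x) ^ (3 * e) = -((-1) ^ e * ((3 * e).choose e : K)) := by
  have h1 : ∀ x : K, x ^ (3 * e) * (1 - x) ^ (3 * e) =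
      ∑ k ∈ Finset.range (3 * e + 1), (-1) ^ k * ((3 * e).choose k : K) * x ^ (3 * e + k) := by
    intro x
    rw [show 1 - x = (-x) + 1 by ring, add_pow, Finset.mul_sum]
    refine Finset.sum_congr rfl fun k _ => ?_
    rw [one_pow, neg_pow, pow_add]
    ring
  simp_rw [h1]
  rw [Finset.sum_comm, Finset.sum_eq_single e]
  · rw [← Finset.mul_sum, FiniteField.sum_pow_eq_ite K (by omega), if_pos ⟨1, by omega⟩]
    ring
  · intro k hk hke
    rw [← Finset.mul_sum, FiniteField.sum_pow_eq_ite K (by omega), if_neg, mul_zero]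
    rintro ⟨t, ht⟩
    rw [← he, Nat.add_sub_cancel] at ht
    have hk' := Finset.mem_range.mp hk
    rcases t with _ | _ | t
    · omega
    · omega
    · have : 4 * e * (t + 1 + 1) = 4 * e * t + 8 * e := by ring
      have : 0 ≤ 4 * e * t := Nat.zero_le _
      omega
  · intro h
    exact absurd (Finset.mem_range.mpr (by omega)) h

/-! ### Quartic characters with values in the Gaussian integers. -/

section QuarticChar

variable {F : Type*} [Field F] [Fintype F] {α : F} {e : ℕ}

theorem FiniteField.exists_eq_pow_of_isPrimitiveRoot {n : ℕ} [NeZero n] (hα : IsPrimitiveRoot α n)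
    (hn : n + 1 = Fintype.card F) {x : F} (hx : x ≠ 0) : ∃ j, x = α ^ j := by
  have h := FiniteField.pow_card_sub_one_eq_one x hx
  rw [← hn, Nat.add_sub_cancel] at h
  obtain ⟨j, -, hj⟩ := hα.eq_pow_of_pow_eq_one h
  exact ⟨j, hj.symm⟩

/-- A root of unity of an order whose cofactor is divisible by `d` is a `d`-th power. -/
theorem FiniteField.exists_eq_pow_pow_of_pow_eq_one {n : ℕ} [NeZero n] (hα : IsPrimitiveRoot α n)
    (hn : n + 1 = Fintype.card F) {x : F} (hx : x ≠ 0) {a b d : ℕ} (hab : n = a * b) (hd : d ∣ b)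
    (hxa : x ^ a = 1) : ∃ y, x = y ^ d := by
  obtain ⟨j, rfl⟩ := FiniteField.exists_eq_pow_of_isPrimitiveRoot hα hn hx
  rw [← pow_mul] at hxa
  have h := hα.dvd_of_pow_eq_one _ hxa
  have ha : 0 < a := Nat.pos_of_ne_zero fun h0 => NeZero.ne n (by rw [hab, h0, zero_mul])
  rw [hab, mul_comm j] at h
  obtain ⟨t, ht⟩ := hd.trans (Nat.dvd_of_mul_dvd_mul_left ha h)
  exact ⟨α ^ t, by rw [ht, ← pow_mul, mul_comm]⟩

/-- The imaginary unit of the Gaussian integers. -/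
def GaussianInt.unitI : GaussianInt := ⟨0, 1⟩

theorem GaussianInt.isPrimitiveRoot_unitI : IsPrimitiveRoot GaussianInt.unitI 4 :=
  .mk_of_lt _ (by norm_num) (by decide) fun l h0 h4 => by interval_cases l <;> decide

theorem GaussianInt.toComplex_unitI : (GaussianInt.unitI : ℂ) = Complex.I := by
  simp [GaussianInt.unitI, GaussianInt.toComplex_def]

theorem exists_mulChar_apply_eq_unitI [NeZero e] (hα : IsPrimitiveRoot α (4 * e))
    (he : 4 * e + 1 = Fintype.card F) :
    ∃ χ : MulChar F GaussianInt, χ α = GaussianInt.unitI := by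
  classical
  have hα0 : α ≠ 0 := hα.ne_zero (by have := NeZero.ne e; omega)
  have hI := GaussianInt.isPrimitiveRoot_unitI
  have hcard : Fintype.card Fˣ = 4 * e := by rw [Fintype.card_units]; omega
  have hζ : (hI.isUnit (by norm_num)).unit ∈ rootsOfUnity (Fintype.card Fˣ) GaussianInt := by
    rw [mem_rootsOfUnity, Units.ext_iff, hcard]
    simp [pow_mul, hI.pow_eq_one]
  have hg : ∀ x, x ∈ Subgroup.zpowers (Units.mk0 α hα0) := fun x => by
    have : NeZero (4 * e) := ⟨by have := NeZero.ne e; omega⟩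
    obtain ⟨j, hj⟩ := FiniteField.exists_eq_pow_of_isPrimitiveRoot hα he x.ne_zero
    exact ⟨j, by ext; simp [hj]⟩
  exact ⟨MulChar.ofRootOfUnity hζ hg, MulChar.ofRootOfUnity_spec hζ hg⟩

variable [NeZero e] (hα : IsPrimitiveRoot α (4 * e)) (he : 4 * e + 1 = Fintype.card F)
  {χ : MulChar F GaussianInt} (hχ : χ α = GaussianInt.unitI)

include hα he hχ

theorem MulChar.apply_eq_one_iff_exists_pow_four {x : F} (hx : x ≠ 0) :
    χ x = 1 ↔ ∃ d, d ^ 4 = x := by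
  have hI := GaussianInt.isPrimitiveRoot_unitI
  have : NeZero (4 * e) := ⟨by have := NeZero.ne e; omega⟩
  obtain ⟨j, rfl⟩ := FiniteField.exists_eq_pow_of_isPrimitiveRoot hα he hx
  constructor
  · intro h
    rw [map_pow, hχ] at h
    obtain ⟨t, rfl⟩ := hI.dvd_of_pow_eq_one _ h
    exact ⟨α ^ t, by rw [← pow_mul, mul_comm]⟩
  · rintro ⟨d, hd⟩
    have hd0 : d ≠ 0 := by rintro rfl; simp at hd; exact hx hd.symm
    obtain ⟨i, rfl⟩ := FiniteField.exists_eq_pow_of_isPrimitiveRoot hα he hd0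
    rw [← hd, map_pow, map_pow, hχ, ← pow_mul, mul_comm, pow_mul, hI.pow_eq_one, one_pow]

theorem MulChar.exists_apply_eq_unitI_pow {x : F} (hx : x ≠ 0) :
    ∃ j < 4, χ x = GaussianInt.unitI ^ j := by
  have hI := GaussianInt.isPrimitiveRoot_unitI
  have : NeZero (4 * e) := ⟨by have := NeZero.ne e; omega⟩
  obtain ⟨j, rfl⟩ := FiniteField.exists_eq_pow_of_isPrimitiveRoot hα he hx
  refine ⟨j % 4, Nat.mod_lt _ (by norm_num), ?_⟩
  rw [map_pow, hχ]
  conv_lhs => rw [← Nat.mod_add_div j 4, pow_add, pow_mul, hI.pow_eq_one, one_pow, mul_one]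

theorem card_pow_four_eq [DecidableEq F] {y : F} (hy : y ≠ 0) :
    (Finset.univ.filter fun x : F => x ^ 4 = y).card = if χ y = 1 then 4 else 0 := by
  have hp : IsPrimitiveRoot (α ^ e) 4 :=
    hα.pow (by have := NeZero.ne e; omega) (mul_comm 4 e)
  have h1 : (Finset.univ.filter fun x : F => x ^ 4 = y) = (Polynomial.nthRoots 4 y).toFinset := by
    ext x
    simp [Polynomial.mem_nthRoots (show 0 < 4 by norm_num)]
  rw [h1, Multiset.toFinset_card_of_nodup (hp.nthRoots_nodup hy), hp.card_nthRoots]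
  have h2 := MulChar.apply_eq_one_iff_exists_pow_four hα he hχ hy
  by_cases h : χ y = 1
  · rw [if_pos h, if_pos (h2.mp h)]
  · rw [if_neg h, if_neg (mt h2.mpr h)]

theorem card_pow_four_eq_sum [DecidableEq F] (y : F) :
    ((Finset.univ.filter fun x : F => x ^ 4 = y).card : GaussianInt) =
      1 + χ y + χ y ^ 2 + χ y ^ 3 := by
  rcases eq_or_ne y 0 with rfl | hy
  · rw [MulChar.map_zero]
    simp [Finset.filter_eq']
  · rw [card_pow_four_eq hα he hχ hy]
    obtain ⟨j, hj, h⟩ := MulChar.exists_apply_eq_unitI_pow hα he hχ hy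
    rw [h]
    interval_cases j <;> decide

/-- The Jacobi sum of a quartic character with itself is prime to `p`. -/
theorem not_dvd_jacobiSum_quartic {p m : ℕ} [Fact p.Prime] [CharP F p] (hp4 : p % 4 = 1)
    (hq : Fintype.card F = p ^ m) : ¬ (p : GaussianInt) ∣ jacobiSum χ χ := by
  have he0 : 0 < e := Nat.pos_of_ne_zero (NeZero.ne e)
  have : NeZero (4 * e) := ⟨by omega⟩
  have hneg : α ^ (2 * e) = -1 := by
    have := (hα.pow (by omega) (show 4 * e = (2 * e) * 2 by ring)).eq_neg_one_of_two_right
    exact this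
  -- Sending `i` to `α^(3e)` makes `χ` reduce to `x ↦ x^(3e)`. The other choice `α^e` would be
  -- useless: the Jacobi sum then reduces to a power sum of degree `2e < q - 1`, which vanishes.
  let red : GaussianInt →+* F := Zsqrtd.lift ⟨α ^ (3 * e), by
    rw [← pow_add, show 3 * e + 3 * e = 4 * e + 2 * e by ring, pow_add, hα.pow_eq_one, hneg]
    simp⟩
  have hI : red GaussianInt.unitI = α ^ (3 * e) := by
    simp [red, GaussianInt.unitI]
  have hred : ∀ x, red (χ x) = x ^ (3 * e) := by
    intro x
    rcases eq_or_ne x 0 with rfl | hx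
    · rw [MulChar.map_zero, map_zero, zero_pow (by omega)]
    · obtain ⟨j, rfl⟩ := FiniteField.exists_eq_pow_of_isPrimitiveRoot hα he hx
      rw [map_pow, hχ, map_pow, hI, ← pow_mul, ← pow_mul, mul_comm]
  rintro ⟨t, ht⟩
  have h1 := congrArg red ht
  rw [map_mul, map_natCast, CharP.cast_eq_zero, zero_mul, jacobiSum, map_sum] at h1
  simp_rw [map_mul, hred] at h1
  rw [FiniteField.sum_pow_mul_one_sub_pow F he he0, neg_eq_zero, mul_eq_zero,
    CharP.cast_eq_zero_iff F p] at h1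
  rcases h1 with h1 | h1
  · exact pow_ne_zero _ (neg_ne_zero.mpr one_ne_zero) h1
  · exact not_dvd_choose_quarter Fact.out hp4 m e (he.trans hq) h1

end QuarticChar

/-! ### The canonical additive character and its Gauss sums. -/

section TraceChar

variable (p : ℕ) [Fact p.Prime] (F : Type*) [Field F] [Fintype F] [Algebra (ZMod p) F]

/-- The canonical additive character of a finite field. -/
noncomputable def traceChar : AddChar F ℂ :=
  (ZMod.stdAddChar (N := p)).compAddMonoidHom (Algebra.trace (ZMod p) F).toAddMonoidHom

variable {F}

omit [Fintype F] in
theorem traceChar_apply (x : F) :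
    traceChar p F x = ZMod.stdAddChar (Algebra.trace (ZMod p) F x) := rfl

theorem traceChar_isPrimitive : (traceChar p F).IsPrimitive := by
  intro a ha h
  refine ha ((traceForm_nondegenerate (ZMod p) F).1 a fun b => ?_)
  have h1 := DFunLike.congr_fun h b
  rw [AddChar.mulShift_apply, traceChar_apply, AddChar.one_apply,
    ← (ZMod.stdAddChar (N := p)).map_zero_eq_one, ZMod.injective_stdAddChar.eq_iff] at h1
  simpa [Algebra.traceForm_apply] using h1

omit [Fintype F] in
theorem isIntegral_traceChar (x : F) : IsIntegral ℤ (traceChar p F x) := by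
  refine IsIntegral.of_pow (n := p) (Fact.out : p.Prime).pos ?_
  rw [traceChar_apply, ← AddChar.map_nsmul_eq_pow, nsmul_eq_mul, CharP.cast_eq_zero, zero_mul,
    AddChar.map_zero_eq_one]
  exact isIntegral_one

/-- If `χ` is trivial on the prime field, its Gauss sum has values in the ring generated by the
values of `χ`. -/
theorem gaussSum_traceChar_eq {R : Type*} [CommRing R] (χ : MulChar F R) (f : R →+* ℂ)
    (hχ : ∀ t : ZMod p, t ≠ 0 → χ (algebraMap (ZMod p) F t) = 1) :
    ∃ g : R, gaussSum (χ.ringHomComp f) (traceChar p F) = f g := by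
  classical
  set S : ZMod p → R := fun t => ∑ x : F with Algebra.trace (ZMod p) F x = t, χ x with hS
  -- Scaling by `t` carries the trace fibre over `1` to the one over `t` without changing `χ`. Hence
  -- the Gauss sum is `S 0 + S 1 · ∑_{t ≠ 0} ζ^t = S 0 - S 1`, with `ζ` a primitive `p`-th root of
  -- unity.
  have hS1 : ∀ t, t ≠ 0 → S t = S 1 := by
    intro t ht
    have ht' : algebraMap (ZMod p) F t ≠ 0 := by simpa using ht
    symm
    refine Finset.sum_bijective (fun x => algebraMap (ZMod p) F t * x)
      (mulLeft_bijective₀ _ ht') (fun x => ?_) fun x _ => ?_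
    · rw [Finset.mem_filter, Finset.mem_filter, ← Algebra.smul_def, map_smul, smul_eq_mul]
      simp [mul_eq_left₀ ht]
    · rw [map_mul, hχ t ht, one_mul]
  refine ⟨S 0 - S 1, ?_⟩
  have h1 : gaussSum (χ.ringHomComp f) (traceChar p F) =
      ∑ t : ZMod p, f (S t) * ZMod.stdAddChar t := by
    rw [gaussSum, ← Finset.sum_fiberwise _ (fun x : F => Algebra.trace (ZMod p) F x)]
    refine Finset.sum_congr rfl fun t _ => ?_
    rw [hS, map_sum, Finset.sum_mul]
    refine Finset.sum_congr rfl fun x hx => ?_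
    rw [traceChar_apply, (Finset.mem_filter.mp hx).2, MulChar.ringHomComp_apply]
  have h2 : ∑ t : ZMod p, ZMod.stdAddChar t = (0 : ℂ) := by
    refine AddChar.sum_eq_zero_of_ne_one fun h => ?_
    have := ZMod.isPrimitive_stdAddChar p (one_ne_zero)
    rw [AddChar.mulShift_one] at this
    exact this h
  have h3 : ∀ t : ZMod p, f (S t) * ZMod.stdAddChar t =
      f (S 1) * ZMod.stdAddChar t + if t = 0 then f (S 0) - f (S 1) else 0 := by
    intro t
    split_ifs with ht
    · rw [ht, AddChar.map_zero_eq_one]; ring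
    · rw [hS1 t ht, add_zero]
  rw [h1, Finset.sum_congr rfl fun t _ => h3 t, Finset.sum_add_distrib, ← Finset.mul_sum, h2,
    Finset.sum_ite_eq' Finset.univ (0 : ZMod p)]
  simp

/-- The exponential sum of `a x ^ 4`. -/
noncomputable def quarticSum (a : F) : ℂ := ∑ x : F, traceChar p F (a * x ^ 4)

theorem quarticSum_mul_pow_four (a : F) {d : F} (hd : d ≠ 0) :
    quarticSum p (a * d ^ 4) = quarticSum p a := by
  refine Fintype.sum_bijective (fun x => d * x) (mulLeft_bijective₀ _ hd) _ _ fun x => ?_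
  rw [mul_pow, mul_assoc]

end TraceChar

/-! ### Quartic exponential sums through Gauss sums. -/

section QuarticSum

variable {p : ℕ} [Fact p.Prime] {F : Type*} [Field F] [Fintype F] [Algebra (ZMod p) F]
  {α : F} {e k : ℕ} [NeZero e] (hα : IsPrimitiveRoot α (4 * e)) (he : 4 * e + 1 = Fintype.card F)

theorem quarticSum_eq_sum_card [DecidableEq F] (a : F) : quarticSum p a =
    ∑ y : F, ((Finset.univ.filter fun x : F => x ^ 4 = y).card : ℂ) * traceChar p F (a * y) := by
  rw [quarticSum, ← Finset.sum_fiberwise _ (fun x : F => x ^ 4)]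
  refine Finset.sum_congr rfl fun y _ => ?_
  rw [← nsmul_eq_mul, ← Finset.sum_const]
  refine Finset.sum_congr rfl fun x hx => ?_
  rw [(Finset.mem_filter.mp hx).2]

include hα he

omit [Fact p.Prime] [Algebra (ZMod p) F] in
/-- The subfield of index four consists of fourth powers. -/
theorem exists_eq_pow_four_of_pow_eq_self (hp4 : p % 4 = 1) (hq : Fintype.card F = p ^ (4 * k))
    {x : F} (hx : x ≠ 0) (hxk : x ^ p ^ k = x) : ∃ y, x = y ^ 4 := by
  have : NeZero (4 * e) := ⟨by have := NeZero.ne e; omega⟩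
  have h1 : p ^ k % 4 = 1 := by rw [Nat.pow_mod, hp4]; simp
  obtain ⟨c, hc⟩ : ∃ c, p ^ k = 4 * c + 1 := ⟨p ^ k / 4, by omega⟩
  -- With `P = p^k`, the cofactor `(P⁴ - 1)/(P - 1) = 1 + P + P² + P³` is divisible by `4` because
  -- `P ≡ 1 (mod 4)`.
  refine FiniteField.exists_eq_pow_pow_of_pow_eq_one hα he hx (a := 4 * c)
    (b := 1 + p ^ k + (p ^ k) ^ 2 + (p ^ k) ^ 3) ?_ ?_ ?_
  · have : 4 * e + 1 = (4 * c + 1) ^ 4 := by rw [he, hq, ← hc, ← pow_mul, mul_comm]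
    rw [hc]
    nlinarith
  · rw [hc]
    exact ⟨16 * c ^ 3 + 16 * c ^ 2 + 6 * c + 1, by ring⟩
  · rw [hc, pow_succ] at hxk
    exact mul_right_cancel₀ hx (by rw [hxk, one_mul])

variable {χ : MulChar F GaussianInt} (hχ : χ α = GaussianInt.unitI)

include hχ

/-- Fourth powering is four-to-one onto the nonzero fourth powers, so apart from the term `x = 0`
the sum is four times a sum of roots of unity. The resulting congruence modulo `4` later settles a
parity. -/
theorem isIntegral_quarticSum_sub_one_div_four (a : F) :
    IsIntegral ℤ ((quarticSum p a - 1) / 4) := by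
  classical
  have h : (quarticSum p a - 1) / 4 =
      ∑ y ∈ Finset.univ.erase (0 : F), if χ y = 1 then traceChar p F (a * y) else 0 := by
    rw [quarticSum_eq_sum_card, ← Finset.add_sum_erase _ _ (Finset.mem_univ (0 : F)),
      div_eq_iff (by norm_num : (4 : ℂ) ≠ 0), Finset.sum_mul]
    have h0 : (Finset.univ.filter fun x : F => x ^ 4 = 0) = {0} := by ext; simp
    rw [h0, mul_zero, AddChar.map_zero_eq_one, Finset.card_singleton, Nat.cast_one, one_mul,
      add_sub_cancel_left]
    refine Finset.sum_congr rfl fun y hy => ?_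
    rw [card_pow_four_eq hα he hχ (Finset.ne_of_mem_erase hy)]
    split_ifs
    · push_cast; ring
    · simp
  rw [h]
  refine IsIntegral.sum _ fun y _ => ?_
  split_ifs
  · exact isIntegral_traceChar p _
  · exact isIntegral_zero

/-- The number of fourth roots of `y` is `1 + ψ y + ψ² y + ψ³ y`; the term `1` contributes nothing
because `a ≠ 0`. -/
theorem quarticSum_eq_gaussSum {a : F} (ha : a ≠ 0) (ψ : MulChar F ℂ)
    (hψ : ψ = χ.ringHomComp GaussianInt.toComplex) :
    quarticSum p a = ψ⁻¹ a * gaussSum ψ (traceChar p F) +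
      ψ⁻¹ a ^ 2 * gaussSum (ψ ^ 2) (traceChar p F) + ψ a * gaussSum ψ⁻¹ (traceChar p F) := by
  classical
  have hψa : ∀ y, ψ y = GaussianInt.toComplex (χ y) := fun y => by
    rw [hψ, MulChar.ringHomComp_apply]
  have h4 : ψ ^ 3 = ψ⁻¹ := by
    refine eq_inv_of_mul_eq_one_left ?_
    rw [← pow_succ]
    ext x
    obtain ⟨j, -, hj⟩ := MulChar.exists_apply_eq_unitI_pow hα he hχ x.ne_zero
    rw [MulChar.pow_apply' _ (by norm_num), hψa, hj, MulChar.one_apply_coe, ← map_pow, ← pow_mul,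
      mul_comm, pow_mul]
    norm_num [GaussianInt.isPrimitiveRoot_unitI.pow_eq_one]
  have hcount : ∀ y : F, ((Finset.univ.filter fun x : F => x ^ 4 = y).card : ℂ) =
      1 + ψ y + (ψ ^ 2) y + ψ⁻¹ y := by
    intro y
    have := congrArg GaussianInt.toComplex (card_pow_four_eq_sum hα he hχ y)
    rw [← h4, MulChar.pow_apply' _ (by norm_num), MulChar.pow_apply' _ (by norm_num), hψa]
    simpa using this
  have h1 : ∑ y : F, traceChar p F (a * y) = 0 := by
    simpa using AddChar.sum_eq_zero_of_ne_one (traceChar_isPrimitive p ha)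
  have h2 : ∀ φ : MulChar F ℂ, ∑ y, φ y * traceChar p F (a * y) =
      φ⁻¹ a * gaussSum φ (traceChar p F) := by
    intro φ
    have := gaussSum_mulShift_eq φ (traceChar p F) (Units.mk0 a ha)
    simpa [gaussSum] using this
  rw [quarticSum_eq_sum_card]
  simp_rw [hcount, add_mul, Finset.sum_add_distrib, h2, one_mul, h1]
  rw [inv_inv, zero_add, ← inv_pow, MulChar.pow_apply' _ two_ne_zero]

end QuarticSum

/-! ### Evaluation of the quartic Gauss sum. -/

section QuarticSumEval

variable {p : ℕ} [Fact p.Prime] {F : Type*} [Field F] [Fintype F] [Algebra (ZMod p) F]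
  {α : F} {e k : ℕ} [NeZero e] (hα : IsPrimitiveRoot α (4 * e)) (he : 4 * e + 1 = Fintype.card F)
  (hp4 : p % 4 = 1) (hq : Fintype.card F = p ^ (4 * k))
  {χ : MulChar F GaussianInt} (hχ : χ α = GaussianInt.unitI)

include hα he hp4 hq hχ

theorem quarticChar_algebraMap {t : ZMod p} (ht : t ≠ 0) : χ (algebraMap (ZMod p) F t) = 1 := by
  have h0 : algebraMap (ZMod p) F t ≠ 0 := by simpa using ht
  rw [MulChar.apply_eq_one_iff_exists_pow_four hα he hχ h0]
  obtain ⟨y, hy⟩ := exists_eq_pow_four_of_pow_eq_self hα he hp4 hq h0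
    (by rw [← map_pow, ZMod.pow_card_pow])
  exact ⟨y, hy.symm⟩

/-- The Gauss sum of a quartic character is `p ^ k` times a primitive Gaussian integer. -/
theorem exists_gaussSum_quartic_eq (ψ : MulChar F ℂ)
    (hψ : ψ = χ.ringHomComp GaussianInt.toComplex) :
    ∃ (s : ℤ) (w : GaussianInt), (s = 1 ∨ s = -1) ∧ w.norm = p ^ (2 * k) ∧
      ¬ (p : GaussianInt) ∣ w ∧ gaussSum (ψ ^ 2) (traceChar p F) = s * p ^ (2 * k) ∧
      gaussSum ψ (traceChar p F) = p ^ k * GaussianInt.toComplex w ∧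
      gaussSum ψ⁻¹ (traceChar p F) = p ^ k * (starRingEnd ℂ) (GaussianInt.toComplex w) := by
  have hpp : p.Prime := Fact.out
  have hp0' : (p : GaussianInt) ≠ 0 := by exact_mod_cast hpp.ne_zero
  have : CharP F p := charP_of_injective_algebraMap (algebraMap (ZMod p) F).injective p
  have hψa : ∀ y, ψ y = GaussianInt.toComplex (χ y) := fun y => by
    rw [hψ, MulChar.ringHomComp_apply]
  have hψneg : ψ (-1) = 1 := by
    have := quarticChar_algebraMap hα he hp4 hq hχ (t := -1) (by simp)
    rw [map_neg, map_one] at this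
    rw [hψa, this, map_one]
  have hψα : ψ α = Complex.I := by rw [hψa, hχ, GaussianInt.toComplex_unitI]
  have hα0 : α ≠ 0 := hα.ne_zero (by have := NeZero.ne e; omega)
  have hψ2 : ψ ^ 2 ≠ 1 := by
    intro h
    have h1 := DFunLike.congr_fun h α
    rw [MulChar.pow_apply' _ two_ne_zero, hψα, MulChar.one_apply hα0.isUnit, Complex.I_sq] at h1
    norm_num at h1
  have hψ1 : ψ ≠ 1 := by rintro rfl; simp at hψ2
  have hψ4 : (ψ ^ 2) ^ 2 = 1 := by
    ext x
    obtain ⟨j, -, hj⟩ := MulChar.exists_apply_eq_unitI_pow hα he hχ x.ne_zero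
    rw [← pow_mul, MulChar.pow_apply' _ (by norm_num), hψa, hj, MulChar.one_apply_coe, ← map_pow,
      ← pow_mul, mul_comm, pow_mul]
    norm_num [GaussianInt.isPrimitiveRoot_unitI.pow_eq_one]
  have hprim := traceChar_isPrimitive p (F := F)
  -- The quadratic Gauss sum squares to `q = (p^(2k))²`; its sign `s` is left open.
  obtain ⟨s, hs, hG2⟩ : ∃ s : ℤ, (s = 1 ∨ s = -1) ∧
      gaussSum (ψ ^ 2) (traceChar p F) = s * p ^ (2 * k) := by
    have h := gaussSum_sq hψ2 (MulChar.isQuadratic_iff_sq_eq_one.mpr hψ4) hprim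
    rw [MulChar.pow_apply' _ two_ne_zero, hψneg, one_pow, one_mul, hq, Nat.cast_pow,
      show 4 * k = 2 * k * 2 by ring, pow_mul, sq_eq_sq_iff_eq_or_eq_neg] at h
    rcases h with h | h
    · exact ⟨1, Or.inl rfl, by rw [h]; simp⟩
    · exact ⟨-1, Or.inr rfl, by rw [h]; simp⟩
  obtain ⟨g, hg⟩ := gaussSum_traceChar_eq p χ GaussianInt.toComplex
    fun t ht => quarticChar_algebraMap hα he hp4 hq hχ ht
  rw [← hψ] at hg
  have hinv : gaussSum ψ⁻¹ (traceChar p F) = (starRingEnd ℂ) (GaussianInt.toComplex g) := by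
    have h := gaussSum_mulShift ψ⁻¹ (traceChar p F) (-1 : Fˣ)
    rw [Units.val_neg, Units.val_one, ← AddChar.inv_mulShift, ← star_gaussSum_eq, hg,
      MulChar.inv_apply', inv_neg, inv_one, hψneg, one_mul] at h
    exact h.symm
  have hJ : jacobiSum ψ ψ = GaussianInt.toComplex (jacobiSum χ χ) := by
    rw [hψ, jacobiSum_ringHomComp]
  have hs2 : (s : GaussianInt) * s = 1 := by rcases hs with rfl | rfl <;> norm_num
  have hgJ : g ^ 2 = s * (p : GaussianInt) ^ (2 * k) * jacobiSum χ χ := by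
    have h := jacobiSum_mul_nontrivial (χ := ψ) (φ := ψ) (by rwa [← sq]) (traceChar p F)
    rw [← sq, hG2, hJ, hg] at h
    apply GaussianInt.toComplex_injective
    rw [map_pow, map_mul, map_mul, map_pow, map_intCast, map_natCast, h, sq]
  have hnorm : g.norm = p ^ (4 * k) := by
    have h := gaussSum_mul_gaussSum_eq_card hψ1 hprim
    rw [← star_gaussSum_eq, hg, hq, Complex.star_def, Complex.mul_conj,
      ← GaussianInt.intCast_complex_norm] at h
    exact_mod_cast h
  -- `p^(2k)` divides `g²`, and `ℤ[i]` is integrally closed.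
  obtain ⟨w, hw⟩ : (p : GaussianInt) ^ k ∣ g := by
    rw [← IsIntegrallyClosed.pow_dvd_pow_iff two_ne_zero, hgJ, ← pow_mul, mul_comm k]
    exact ⟨s * jacobiSum χ χ, by ring⟩
  refine ⟨s, w, hs, ?_, ?_, hG2, ?_, ?_⟩
  · have h1 : ((p : GaussianInt) ^ k).norm = p ^ (2 * k) := by
      rw [← Nat.cast_pow, Zsqrtd.norm_natCast]
      push_cast
      ring
    rw [hw, Zsqrtd.norm_mul, h1, show 4 * k = 2 * k + 2 * k by ring, pow_add] at hnorm
    exact mul_left_cancel₀ (pow_ne_zero _ (by exact_mod_cast hpp.ne_zero)) hnorm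
  · intro h
    apply not_dvd_jacobiSum_quartic hα he hχ hp4 hq
    have h2 : w ^ 2 = s * jacobiSum χ χ := by
      rw [hw] at hgJ
      refine mul_left_cancel₀ (pow_ne_zero (2 * k) hp0') ?_
      linear_combination hgJ
    have h3 : jacobiSum χ χ = s * w ^ 2 := by
      rw [h2, ← mul_assoc, hs2, one_mul]
    rw [h3, sq]
    exact (h.mul_right _).mul_left _
  · rw [hg, hw, map_mul, map_pow, map_natCast]
  · rw [hinv, hw, map_mul, map_pow, map_natCast, map_mul, map_pow, map_natCast]

theorem exists_quarticSum_eq : ∃ s A B : ℤ, (s = 1 ∨ s = -1) ∧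
    A ^ 2 + B ^ 2 = (p : ℤ) ^ (2 * k) ∧ ¬ (p : ℤ) ∣ A ∧ ¬ (p : ℤ) ∣ B ∧
    4 ∣ s * (p : ℤ) ^ (2 * k) + 2 * (p : ℤ) ^ k * A - 1 ∧
    ∀ j, quarticSum p (α ^ j) = (
      if j % 4 = 0 then s * (p : ℤ) ^ (2 * k) + 2 * (p : ℤ) ^ k * A
      else if j % 4 = 1 then -(s * (p : ℤ) ^ (2 * k)) + 2 * (p : ℤ) ^ k * B
      else if j % 4 = 2 then s * (p : ℤ) ^ (2 * k) - 2 * (p : ℤ) ^ k * A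
      else -(s * (p : ℤ) ^ (2 * k)) - 2 * (p : ℤ) ^ k * B : ℤ) := by
  have hpp : p.Prime := Fact.out
  have hpZ : Prime (p : ℤ) := Nat.prime_iff_prime_int.mp hpp
  have hα0 : α ≠ 0 := hα.ne_zero (by have := NeZero.ne e; omega)
  obtain ⟨s, w, hs, hnorm, hpw, hG2, hG, hG'⟩ := exists_gaussSum_quartic_eq hα he hp4 hq hχ _ rfl
  have hAB : w.re ^ 2 + w.im ^ 2 = (p : ℤ) ^ (2 * k) := by
    rw [← hnorm, Zsqrtd.norm_def]; ring
  have hpk : (p : ℤ) ∣ (p : ℤ) ^ (2 * k) := by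
    refine dvd_pow_self _ fun h => ?_
    have hk : k = 0 := by omega
    rw [hk] at hq
    have := NeZero.ne e
    simp at hq
    omega
  have hpw' : ¬ ((p : ℤ) ∣ w.re ∧ (p : ℤ) ∣ w.im) := by
    rw [← Zsqrtd.intCast_dvd]; exact_mod_cast hpw
  have hT : ∀ j, quarticSum p (α ^ j) = (
      if j % 4 = 0 then s * (p : ℤ) ^ (2 * k) + 2 * (p : ℤ) ^ k * w.re
      else if j % 4 = 1 then -(s * (p : ℤ) ^ (2 * k)) + 2 * (p : ℤ) ^ k * w.im
      else if j % 4 = 2 then s * (p : ℤ) ^ (2 * k) - 2 * (p : ℤ) ^ k * w.re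
      else -(s * (p : ℤ) ^ (2 * k)) - 2 * (p : ℤ) ^ k * w.im : ℤ) := by
    intro j
    rw [quarticSum_eq_gaussSum hα he hχ (pow_ne_zero j hα0) _ rfl, hG2, hG, hG',
      MulChar.inv_apply_eq_inv', MulChar.ringHomComp_apply, map_pow, hχ, map_pow,
      GaussianInt.toComplex_unitI, Complex.I_pow_eq_pow_mod]
    have hj : j % 4 < 4 := Nat.mod_lt _ (by norm_num)
    interval_cases j % 4 <;>
      simp [GaussianInt.toComplex_def, pow_succ] <;> ring_nf <;> simp
  refine ⟨s, w.re, w.im, hs, hAB, fun h => hpw' ⟨h, ?_⟩, fun h => hpw' ⟨?_, h⟩, ?_, hT⟩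
  · refine hpZ.dvd_of_dvd_pow (n := 2) ?_
    rw [← hAB] at hpk
    exact (dvd_add_right (dvd_pow h two_ne_zero)).mp hpk
  · refine hpZ.dvd_of_dvd_pow (n := 2) ?_
    rw [← hAB] at hpk
    exact (dvd_add_left (dvd_pow h two_ne_zero)).mp hpk
  · have h := isIntegral_quarticSum_sub_one_div_four (p := p) hα he hχ (α ^ 0)
    rw [hT 0, if_pos rfl] at h
    set n : ℤ := s * (p : ℤ) ^ (2 * k) + 2 * (p : ℤ) ^ k * w.re
    have h1 : ((n : ℂ) - 1) / 4 = algebraMap ℚ ℂ (((n : ℚ) - 1) / 4) := by simp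
    rw [h1, isIntegral_algebraMap_iff (algebraMap ℚ ℂ).injective,
      IsIntegrallyClosed.isIntegral_iff] at h
    obtain ⟨t, ht⟩ := h
    refine ⟨t, ?_⟩
    rw [eq_div_iff (by norm_num)] at ht
    have : ((t * 4 : ℤ) : ℚ) = ((n - 1 : ℤ) : ℚ) := by push_cast; exact_mod_cast ht
    have := Int.cast_injective this
    omega

end QuarticSumEval

/-! ### The maximum of the quartic sum. -/

section QuarticSumMax

variable {p : ℕ} [Fact p.Prime] {F : Type*} [Field F] [Fintype F] [Algebra (ZMod p) F]
  {α : F} {e k : ℕ} [NeZero e] (hα : IsPrimitiveRoot α (4 * e)) (he : 4 * e + 1 = Fintype.card F)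
  (hp4 : p % 4 = 1) (hq : Fintype.card F = p ^ (4 * k))

include hα he hp4 hq

/-- Modulo `4` the congruence for `S(1)` reads `s + 2A ≡ 1`, so `A` is even for `s = 1` and odd for
`s = -1`. Either way the even coordinate of `w` goes with the leading term `+p^(2k)`, so the sign
`s` need not be known. -/
theorem exists_quarticSum_values : ∃ O E : ℤ, Odd O ∧ Even E ∧
    O ^ 2 + E ^ 2 = (p : ℤ) ^ (2 * k) ∧ ¬ (p : ℤ) ∣ O ∧
    (∀ a : F, a ≠ 0 → ∃ t : ℤ, quarticSum p a = t ∧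
      (t = (p : ℤ) ^ (2 * k) + 2 * (p : ℤ) ^ k * E ∨ t = (p : ℤ) ^ (2 * k) - 2 * (p : ℤ) ^ k * E ∨
      t = -(p : ℤ) ^ (2 * k) + 2 * (p : ℤ) ^ k * O ∨
      t = -(p : ℤ) ^ (2 * k) - 2 * (p : ℤ) ^ k * O)) ∧
    (∃ a : F, a ≠ 0 ∧ quarticSum p a = ((p : ℤ) ^ (2 * k) + 2 * (p : ℤ) ^ k * E : ℤ)) ∧
    ∃ a : F, a ≠ 0 ∧ quarticSum p a = ((p : ℤ) ^ (2 * k) - 2 * (p : ℤ) ^ k * E : ℤ) := by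
  have : NeZero (4 * e) := ⟨by have := NeZero.ne e; omega⟩
  have hα0 : α ≠ 0 := hα.ne_zero (by have := NeZero.ne e; omega)
  obtain ⟨χ, hχ⟩ := exists_mulChar_apply_eq_unitI hα he
  obtain ⟨s, A, B, hs, hAB, hpA, hpB, h4, hT⟩ := exists_quarticSum_eq hα he hp4 hq hχ
  have hp1 : ∀ n, (p : ℤ) ^ n % 4 = 1 := fun n => by
    have : p ^ n % 4 = 1 := by rw [Nat.pow_mod, hp4]; simp
    exact_mod_cast congrArg (Nat.cast (R := ℤ)) this
  have hval : ∀ a : F, a ≠ 0 → ∃ j, j % 4 < 4 ∧ a = α ^ j := fun a ha =>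
    (FiniteField.exists_eq_pow_of_isPrimitiveRoot hα he ha).imp fun j hj =>
      ⟨Nat.mod_lt _ (by norm_num), hj⟩
  have h1 := hp1 (2 * k)
  have h2 := hp1 k
  have hpar : (p : ℤ) ^ k * A % 2 = A % 2 := by
    rw [Int.mul_emod, show (p : ℤ) ^ k % 2 = 1 by omega]; simp
  rw [mul_assoc 2] at h4
  have hodd : Odd (A ^ 2 + B ^ 2) := by rw [hAB, Int.odd_iff]; omega
  have hsum : Odd (A + B) := by
    rw [Int.odd_add, Int.odd_pow' two_ne_zero, Int.even_pow' two_ne_zero] at hodd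
    rwa [Int.odd_add]
  rcases hs with rfl | rfl
  · have hA : Even A := by rw [Int.even_iff]; omega
    have hB : Odd B := by rw [Int.odd_add'] at hsum; exact hsum.mpr hA
    refine ⟨B, A, hB, hA, by rw [← hAB]; ring, hpB, fun a ha => ?_,
      ⟨α ^ 0, pow_ne_zero _ hα0, ?_⟩, ⟨α ^ 2, pow_ne_zero _ hα0, ?_⟩⟩
    · obtain ⟨j, hj, rfl⟩ := hval a ha
      refine ⟨_, hT j, ?_⟩
      interval_cases j % 4 <;> simp
    · rw [hT]; norm_num
    · rw [hT]; norm_num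
  · have hA : Odd A := by rw [Int.odd_iff]; omega
    have hB : Even B := by rw [Int.odd_add] at hsum; exact hsum.mp hA
    refine ⟨A, B, hA, hB, hAB, hpA, fun a ha => ?_,
      ⟨α ^ 1, pow_ne_zero _ hα0, ?_⟩, ⟨α ^ 3, pow_ne_zero _ hα0, ?_⟩⟩
    · obtain ⟨j, hj, rfl⟩ := hval a ha
      refine ⟨_, hT j, ?_⟩
      interval_cases j % 4 <;> simp
    · rw [hT]; norm_num
    · rw [hT]; norm_num

/-- The largest value of the quartic exponential sum over a nonzero parameter. -/
theorem exists_isQuarticRep_isMax_quarticSum : ∃ u v : ℤ, IsQuarticRep p (4 * k) u v ∧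
    (∀ a : F, a ≠ 0 → ∃ t : ℤ, quarticSum p a = t ∧
      t ≤ (p : ℤ) ^ (2 * k) + 4 * (p : ℤ) ^ k * |v|) ∧
    ∃ a : F, a ≠ 0 ∧ quarticSum p a = ((p : ℤ) ^ (2 * k) + 4 * (p : ℤ) ^ k * |v| : ℤ) := by
  obtain ⟨O, E, hO, ⟨v, rfl⟩, hOE, hpO, hval, h1, h2⟩ := exists_quarticSum_values hα he hp4 hq
  have hpZ : Prime (p : ℤ) := Nat.prime_iff_prime_int.mp Fact.out
  have hP : 0 ≤ (p : ℤ) ^ k := by positivity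
  have hPP : (p : ℤ) ^ (2 * k) = (p : ℤ) ^ k * (p : ℤ) ^ k := by rw [two_mul, pow_add]
  obtain ⟨u, hu, hu4⟩ : ∃ u, (u = O ∨ u = -O) ∧ u ≡ 1 [ZMOD 4] := by
    rw [Int.odd_iff] at hO
    rcases (by omega : O % 4 = 1 ∨ O % 4 = 3) with h | h
    · exact ⟨O, Or.inl rfl, h⟩
    · exact ⟨-O, Or.inr rfl, by rw [Int.ModEq]; omega⟩
  have huO : u ^ 2 = O ^ 2 := by rcases hu with rfl | rfl <;> ring
  refine ⟨u, v, ⟨?_, hu4, ?_⟩, fun a ha => ?_, ?_⟩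
  · rw [show 4 * k / 2 = 2 * k by omega, ← hOE, huO]; ring
  · refine (hpZ.coprime_iff_not_dvd.mpr fun h => hpO ?_).symm
    rcases hu with rfl | rfl
    · exact h
    · exact (dvd_neg).mp h
  · obtain ⟨t, ht, h⟩ := hval a ha
    refine ⟨t, ht, ?_⟩
    have hv1 : (p : ℤ) ^ k * v ≤ (p : ℤ) ^ k * |v| := mul_le_mul_of_nonneg_left (le_abs_self v) hP
    have hv2 : (p : ℤ) ^ k * (-v) ≤ (p : ℤ) ^ k * |v| :=
      mul_le_mul_of_nonneg_left (neg_le_abs v) hP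
    have hv3 : 0 ≤ (p : ℤ) ^ k * |v| := by positivity
    -- This keeps the two values with leading term `-p^(2k)` at most `p^(2k)`.
    have hO1 : |O| ≤ (p : ℤ) ^ k := by
      refine abs_le_of_sq_le_sq ?_ hP
      nlinarith [sq_nonneg (v + v)]
    have hO2 : (p : ℤ) ^ k * |O| ≤ (p : ℤ) ^ k * (p : ℤ) ^ k := mul_le_mul_of_nonneg_left hO1 hP
    have hO3 : (p : ℤ) ^ k * O ≤ (p : ℤ) ^ k * |O| := mul_le_mul_of_nonneg_left (le_abs_self O) hP
    have hO4 : (p : ℤ) ^ k * (-O) ≤ (p : ℤ) ^ k * |O| :=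
      mul_le_mul_of_nonneg_left (neg_le_abs O) hP
    rcases h with h | h | h | h <;> nlinarith
  · rcases abs_choice v with h | h <;> rw [h]
    · obtain ⟨a, ha, h⟩ := h1
      exact ⟨a, ha, h.trans (congrArg _ (by ring))⟩
    · obtain ⟨a, ha, h⟩ := h2
      exact ⟨a, ha, h.trans (congrArg _ (by ring))⟩

end QuarticSumMax

theorem IsQuarticRep.abs_eq {p m : ℕ} (hp : p.Prime) (hp4 : p % 4 = 1) {u v u' v' : ℤ}
    (h : IsQuarticRep p m u v) (h' : IsQuarticRep p m u' v') : |v| = |v'| := by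
  have hpZ : Prime (p : ℤ) := Nat.prime_iff_prime_int.mp hp
  have key : ∀ {u v : ℤ}, IsQuarticRep p m u v →
      (p : ℤ) ^ (m / 2) = u ^ 2 + (2 * v) ^ 2 ∧ ¬ (p : ℤ) ∣ u ∧ Odd u := by
    intro u v h
    refine ⟨by rw [h.1]; ring, hpZ.coprime_iff_not_dvd.mp h.2.2.symm, ?_⟩
    have : u % 4 = 1 % 4 := h.2.1
    rw [Int.odd_iff]; omega
  obtain ⟨h1, h2, h3⟩ := key h
  obtain ⟨h1', h2', h3'⟩ := key h'
  have := sq_eq_sq_of_sum_two_sq_eq_prime_pow hp (by omega) h1 h1' h2 h2' h3 (even_two_mul v) h3'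
    (even_two_mul v')
  exact sq_eq_sq_iff_abs_eq_abs v v' |>.mp (by linarith)

/-! ### Replacing `N`-th powers by fourth powers. -/

/-- A Bézout relation `sa + tb = 1` completes `(a, b)` to a matrix of determinant one, which acts
bijectively on `G × G`. -/
theorem Fintype.sum_prod_coprime_smul {G M : Type*} [AddCommGroup G] [Fintype G]
    [AddCommMonoid M] {a b : ℤ} (hab : IsCoprime a b) (g : G → M) :
    ∑ x : G × G, g (a • x.1 + b • x.2) = Fintype.card G • ∑ w, g w := by
  obtain ⟨s, t, hst⟩ := hab
  have h : ∑ x : G × G, g (a • x.1 + b • x.2) = ∑ x : G × G, g x.1 := by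
    refine Fintype.sum_bijective (fun x : G × G => (a • x.1 + b • x.2, (-t) • x.1 + s • x.2))
      ((Finite.injective_iff_bijective).mp fun x y hxy => ?_) _ _ fun x => rfl
    obtain ⟨h1, h2⟩ := Prod.mk.inj hxy
    have e1 : ∀ x : G × G, x.1 = s • (a • x.1 + b • x.2) - b • ((-t) • x.1 + s • x.2) := by
      intro x
      match_scalars
      · linear_combination -hst
      · ring
    have e2 : ∀ x : G × G, x.2 = t • (a • x.1 + b • x.2) + a • ((-t) • x.1 + s • x.2) := by
      intro x
      match_scalars
      · linear_combination -hst
      · ring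
    exact Prod.ext (by rw [e1 x, h1, h2, ← e1 y]) (by rw [e2 x, h1, h2, ← e2 y])
  rw [h, Fintype.sum_prod_type]
  simp only [Finset.sum_const, Finset.card_univ]
  rw [Finset.smul_sum]

/-- With `N = da`, `M = db`, the element `w = y^a z^b` is equidistributed over pairs `(y, z)`, while
`w^d = y^N z^M` and `g` ignores `z^M`. -/
theorem Fintype.sum_pow_eq_sum_pow_gcd {G : Type*} [CommGroup G] [Fintype G] {N M d : ℕ}
    (hd : 0 < d) (hNM : N.gcd M = d) (g : G → ℂ) (hg : ∀ z w, g (w * z ^ M) = g w) :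
    ∑ y, g (y ^ N) = ∑ w, g (w ^ d) := by
  obtain ⟨a, ha⟩ : d ∣ N := hNM ▸ Nat.gcd_dvd_left N M
  obtain ⟨b, hb⟩ : d ∣ M := hNM ▸ Nat.gcd_dvd_right N M
  have hab : IsCoprime (a : ℤ) (b : ℤ) := by
    rw [Nat.isCoprime_iff_coprime]
    rw [ha, hb, Nat.gcd_mul_left] at hNM
    exact Nat.eq_of_mul_eq_mul_left hd (by rw [hNM, mul_one])
  have h := Fintype.sum_prod_coprime_smul (G := Additive G) hab fun w => g (w.toMul ^ d)
  have h1 : ∑ x : Additive G × Additive G, g (((a : ℤ) • x.1 + (b : ℤ) • x.2).toMul ^ d) =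
      Fintype.card (Additive G) • ∑ y, g (y ^ N) := by
    rw [Fintype.sum_prod_type]
    rw [Finset.smul_sum]
    refine Fintype.sum_equiv Additive.toMul _ _ fun y => ?_
    rw [← Finset.card_univ, ← Finset.sum_const]
    refine Finset.sum_congr rfl fun z _ => ?_
    rw [toMul_add, toMul_zsmul, toMul_zsmul, zpow_natCast, zpow_natCast, mul_pow, ← pow_mul,
      ← pow_mul, mul_comm a, mul_comm b, ← ha, ← hb, hg]
  have h2 : ∑ w : Additive G, g (w.toMul ^ d) = ∑ w : G, g (w ^ d) :=
    Fintype.sum_equiv Additive.toMul _ _ fun _ => rfl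
  rw [h1, h2] at h
  rw [nsmul_eq_mul, nsmul_eq_mul] at h
  exact mul_left_cancel₀ (Nat.cast_ne_zero.mpr (Fintype.card_ne_zero (α := Additive G))) h

theorem Finset.sum_range_mul_of_periodic {M : Type*} [AddCommMonoid M] {n : ℕ} {g : ℕ → M}
    (hg : ∀ i, g (i + n) = g i) (N : ℕ) :
    ∑ i ∈ Finset.range (N * n), g i = N • ∑ i ∈ Finset.range n, g i := by
  have h : ∀ k i, g (k * n + i) = g i := by
    intro k i
    induction k with
    | zero => simp
    | succ k ih => rw [show (k + 1) * n + i = k * n + i + n by ring, hg, ih]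
  induction N with
  | zero => simp
  | succ N ih =>
    rw [Nat.succ_mul, Finset.sum_range_add, ih, succ_nsmul]
    congr 1
    exact Finset.sum_congr rfl fun i _ => h N i

theorem FiniteField.sum_units_eq_sum_range {F M : Type*} [Field F] [Fintype F]
    [DecidableEq F] [AddCommMonoid M] {α : F} {n : ℕ} [NeZero n] (hα : IsPrimitiveRoot α n)
    (hn : n + 1 = Fintype.card F) (g : F → M) :
    ∑ y : Fˣ, g y = ∑ j ∈ Finset.range n, g (α ^ j) := by
  have hα0 : α ≠ 0 := hα.ne_zero (NeZero.ne n)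
  symm
  refine Finset.sum_bij (fun j _ => Units.mk0 (α ^ j) (pow_ne_zero j hα0))
    (fun _ _ => Finset.mem_univ _) (fun i hi j hj h => ?_) (fun y _ => ?_) fun _ _ => rfl
  · exact hα.pow_inj (Finset.mem_range.mp hi) (Finset.mem_range.mp hj)
      (congrArg Units.val h)
  · obtain ⟨j, hj⟩ := FiniteField.exists_eq_pow_of_isPrimitiveRoot hα hn y.ne_zero
    refine ⟨j % n, Finset.mem_range.mpr (Nat.mod_lt _ (NeZero.pos n)), ?_⟩
    ext
    rw [Units.val_mk0, hj]
    conv_rhs => rw [← Nat.mod_add_div j n, pow_add, pow_mul, hα.pow_eq_one, one_pow, mul_one]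

/-! ### Support sizes as exponential sums. -/

section SubspaceCount

variable {p : ℕ} [Fact p.Prime] {F : Type*} [Field F] [Fintype F] [Algebra (ZMod p) F]
  (H : Submodule (ZMod p) F)

omit [Fintype F] in
theorem sum_traceChar_submodule [Fintype H] (y : F)
    [Decidable (∀ a ∈ H, Algebra.trace (ZMod p) F (a * y) = 0)] :
    ∑ a : H, traceChar p F (a * y) =
      if ∀ a ∈ H, Algebra.trace (ZMod p) F (a * y) = 0
        then (p : ℂ) ^ Module.finrank (ZMod p) H else 0 := by
  classical
  have h := AddChar.sum_eq_ite
    ((traceChar p F).compAddMonoidHom ((AddMonoidHom.mulRight y).comp H.subtype.toAddMonoidHom))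
  have h1 : (traceChar p F).compAddMonoidHom
      ((AddMonoidHom.mulRight y).comp H.subtype.toAddMonoidHom) = 0 ↔
      ∀ a ∈ H, Algebra.trace (ZMod p) F (a * y) = 0 := by
    rw [AddChar.eq_zero_iff, Subtype.forall]
    refine forall₂_congr fun a ha => ?_
    have h2 : (traceChar p F).compAddMonoidHom
      ((AddMonoidHom.mulRight y).comp H.subtype.toAddMonoidHom) ⟨a, ha⟩ =
      ZMod.stdAddChar (Algebra.trace (ZMod p) F (a * y)) := rfl
    rw [h2, ← (ZMod.stdAddChar (N := p)).map_zero_eq_one, ZMod.injective_stdAddChar.eq_iff]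
  have h3 : ∑ a : H, traceChar p F (a * y) = ∑ a, ((traceChar p F).compAddMonoidHom
      ((AddMonoidHom.mulRight y).comp H.subtype.toAddMonoidHom)) a := rfl
  rw [h3, h, Module.card_eq_pow_finrank (K := ZMod p), ZMod.card, Nat.cast_pow]
  by_cases h4 : ∀ a ∈ H, Algebra.trace (ZMod p) F (a * y) = 0
  · rw [if_pos h4, if_pos (h1.mpr h4)]
  · rw [if_neg h4, if_neg (mt h1.mp h4)]

variable {α θ : F} {n N n₁ m : ℕ} [NeZero n] (hα : IsPrimitiveRoot α n)
  (hn : n + 1 = Fintype.card F) (hm : Fintype.card F = p ^ m) (hNn : N * n₁ = n)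
  (hN : N.gcd (n / (p - 1)) = 4) (hθ : θ = α ^ N)

-- The exponent is `(q-1)/(p-1)`, so the power is the norm to the prime field.
omit [NeZero n] in
include hm in
theorem exists_algebraMap_eq_pow (hn : n + 1 = Fintype.card F) (z : F) :
    ∃ t : ZMod p, algebraMap (ZMod p) F t = z ^ (n / (p - 1)) := by
  refine ⟨Algebra.norm (ZMod p) z, ?_⟩
  have hpp : p.Prime := Fact.out
  have hfin : Module.finrank (ZMod p) F = m := by
    have h := Module.card_eq_pow_finrank (K := ZMod p) (V := F)
    rw [hm, ZMod.card] at h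
    exact (Nat.pow_right_injective hpp.two_le h).symm
  rw [FiniteField.algebraMap_norm_eq_pow_sum, hfin, Nat.card_zmod, Nat.geomSum_eq hpp.two_le,
    show n = p ^ m - 1 by omega]

include hα hn hm hNn hN hθ

/-- The support size of a subcode in terms of quartic exponential sums. -/
theorem card_trace_ne_zero_eq_sum [Fintype H] [DecidableEq H] :
    (N : ℂ) * p ^ Module.finrank (ZMod p) H *
      ({i : Fin n₁ | ∃ a ∈ H, Algebra.trace (ZMod p) F (a * θ ^ (i : ℕ)) ≠ 0}.ncard : ℂ) =
    ∑ a ∈ Finset.univ.erase (0 : H), ((Fintype.card F : ℂ) - quarticSum p (a : F)) := by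
  classical
  set r := Module.finrank (ZMod p) H
  set Z : F → Prop := fun y => ∀ a ∈ H, Algebra.trace (ZMod p) F (a * y) = 0 with hZ
  -- At `θ^i`, `g` marks the coordinates outside the support. It is invariant under scaling by
  -- `𝔽_p^×`.
  set g : F → ℂ := fun y => if Z y then 1 else 0 with hg
  have hgZ : ∀ y, (p : ℂ) ^ r * g y = ∑ a : H, traceChar p F (a * y) := by
    intro y
    rw [sum_traceChar_submodule H y]
    by_cases h : Z y
    · simp only [hg, if_pos h, mul_one]
      exact (if_pos h).symm
    · simp only [hg, if_neg h, mul_zero]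
      exact (if_neg h).symm
  have hginv : ∀ z w : Fˣ, g ((w * z ^ (n / (p - 1)) : Fˣ) : F) = g w := by
    intro z w
    obtain ⟨t, ht⟩ := exists_algebraMap_eq_pow hm hn (z : F)
    have ht0 : t ≠ 0 := by
      rintro rfl
      rw [map_zero] at ht
      exact pow_ne_zero _ z.ne_zero ht.symm
    have : Z ((w * z ^ (n / (p - 1)) : Fˣ) : F) ↔ Z w := by
      refine forall₂_congr fun a _ => ?_
      rw [Units.val_mul, Units.val_pow_eq_pow_val, ← ht,
        show a * ((w : F) * algebraMap (ZMod p) F t) = t • (a * w) by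
          rw [Algebra.smul_def]; ring, map_smul, smul_eq_mul, mul_eq_zero, or_iff_right ht0]
    simp only [hg, this]
  have h1 : ∑ y : Fˣ, g ((y : F) ^ N) = ∑ y : Fˣ, g ((y : F) ^ 4) := by
    have := Fintype.sum_pow_eq_sum_pow_gcd (by norm_num) hN (fun y : Fˣ => g y) hginv
    simpa using this
  have hθ1 : θ ^ n₁ = 1 := by rw [hθ, ← pow_mul, hNn, hα.pow_eq_one]
  have h2 : ∑ y : Fˣ, g ((y : F) ^ N) = N * ∑ i ∈ Finset.range n₁, g (θ ^ i) := by
    -- As `y` runs over the units, `y^N` runs `N` times through `θ^0, …, θ^(n₁-1)`.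
    rw [FiniteField.sum_units_eq_sum_range hα hn (fun y => g (y ^ N)), ← nsmul_eq_mul,
      ← Finset.sum_range_mul_of_periodic (fun i => by rw [pow_add, hθ1, mul_one]), hNn]
    refine Finset.sum_congr rfl fun j _ => ?_
    rw [hθ, ← pow_mul, ← pow_mul, mul_comm]
  have h3 : ∑ y : Fˣ, g ((y : F) ^ 4) = ∑ x : F, g (x ^ 4) - 1 := by
    rw [← Finset.add_sum_erase _ _ (Finset.mem_univ (0 : F))]
    have h0 : g (0 ^ 4) = 1 := by simp [hg, hZ]
    rw [h0, add_sub_cancel_left]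
    refine Finset.sum_bij (fun y _ => (y : F)) (fun y _ => by simp) (fun _ _ _ _ h => Units.ext h)
      (fun x hx => ⟨Units.mk0 x (Finset.ne_of_mem_erase hx), Finset.mem_univ _, rfl⟩)
      fun _ _ => rfl
  have h4 : (p : ℂ) ^ r * ∑ x : F, g (x ^ 4) = ∑ a : H, quarticSum p (a : F) := by
    simp_rw [Finset.mul_sum, hgZ, quarticSum]
    exact Finset.sum_comm
  have h5 : ({i : Fin n₁ | ∃ a ∈ H, Algebra.trace (ZMod p) F (a * θ ^ (i : ℕ)) ≠ 0}.ncard : ℂ) =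
      n₁ - ∑ i ∈ Finset.range n₁, g (θ ^ i) := by
    have : {i : Fin n₁ | ∃ a ∈ H, Algebra.trace (ZMod p) F (a * θ ^ (i : ℕ)) ≠ 0} =
        ((Finset.univ.filter fun i : Fin n₁ => ¬ Z (θ ^ (i : ℕ)) : Finset (Fin n₁)) :
          Set (Fin n₁)) := by
      ext i; simp [hZ]
    rw [this, Set.ncard_coe_finset, Finset.sum_range (fun i => g (θ ^ i)), eq_sub_iff_add_eq]
    simp only [hg]
    rw [Finset.sum_boole, ← Nat.cast_add, add_comm, Finset.card_filter_add_card_filter_not]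
    simp
  have h6 : quarticSum p ((0 : H) : F) = Fintype.card F := by simp [quarticSum]
  have h7 : (Fintype.card H : ℂ) = (p : ℂ) ^ r := by
    rw [Module.card_eq_pow_finrank (K := ZMod p), ZMod.card, Nat.cast_pow]
  have h8 : (N : ℂ) * n₁ = Fintype.card F - 1 := by
    rw [← hn, ← hNn]; push_cast; ring
  rw [← Finset.add_sum_erase _ _ (Finset.mem_univ (0 : H)), h6] at h4
  rw [Finset.sum_sub_distrib, Finset.sum_const, Finset.card_erase_of_mem (Finset.mem_univ _),
    Finset.card_univ, nsmul_eq_mul, Nat.cast_sub Fintype.card_pos, h7, h5]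
  rw [h1, h3] at h2
  push_cast
  linear_combination (p : ℂ) ^ r * h8 + (p : ℂ) ^ r * h2 - h4

end SubspaceCount

/-! ### Generalized Hamming weights and the extremal subspace. -/

theorem exists_submodule_finrank_eq (K : Type*) {V : Type*} [Field K] [AddCommGroup V] [Module K V]
    {r : ℕ} (hr : r ≤ Module.finrank K V) :
    ∃ W : Submodule K V, Module.finrank K W = r := by
  obtain ⟨f, hf⟩ := exists_linearIndependent_of_le_finrank hr
  exact ⟨Submodule.span K (Set.range f), by simpa using finrank_span_eq_card hf⟩

/-- Generalized Hamming weights computed on the source of an injective encoding map. -/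
theorem ghw_range_eq {K V ι : Type*} [Field K] [AddCommGroup V] [Module K V]
    (Φ : V →ₗ[K] ι → K) (hΦ : Function.Injective Φ) (H₀ : Submodule K V)
    (hmin : ∀ H : Submodule K V, Module.finrank K H = Module.finrank K H₀ →
      {i | ∃ a ∈ H₀, Φ a i ≠ 0}.ncard ≤ {i | ∃ a ∈ H, Φ a i ≠ 0}.ncard) :
    ghw (LinearMap.range Φ) (Module.finrank K H₀) = {i | ∃ a ∈ H₀, Φ a i ≠ 0}.ncard := by
  have hfin : ∀ H : Submodule K V, Module.finrank K (H.map Φ) = Module.finrank K H := fun H =>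
    (LinearEquiv.finrank_eq (Submodule.equivMapOfInjective Φ hΦ H)).symm
  have hsupp : ∀ H : Submodule K V, codeSupport (H.map Φ) = {i | ∃ a ∈ H, Φ a i ≠ 0} := by
    intro H
    ext i
    simp [codeSupport]
  refine IsLeast.csInf_eq ⟨⟨H₀.map Φ, LinearMap.map_le_range, hfin H₀, by rw [hsupp]⟩, ?_⟩
  rintro w ⟨U, hU, hr, rfl⟩
  have hUΦ : (U.comap Φ).map Φ = U := Submodule.map_comap_eq_self hU
  rw [← hUΦ, hsupp]
  exact hmin _ (by rw [← hr, ← hfin, hUΦ])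

/-- A space of dimension `r` all of whose nonzero elements are `a` times a fourth power. -/
theorem exists_submodule_subset_mul_pow_four {p : ℕ} [Fact p.Prime] {F : Type*} [Field F]
    [Fintype F] [Algebra (ZMod p) F] {α : F} {e k : ℕ} [NeZero e]
    (hα : IsPrimitiveRoot α (4 * e)) (he : 4 * e + 1 = Fintype.card F) (hp4 : p % 4 = 1)
    (hq : Fintype.card F = p ^ (4 * k)) {a : F} (ha : a ≠ 0) {r : ℕ} (hr : r ≤ k) (hk : k ≠ 0) :
    ∃ H : Submodule (ZMod p) F, Module.finrank (ZMod p) H = r ∧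
      ∀ b ∈ H, b ≠ 0 → ∃ d, d ≠ 0 ∧ b = a * d ^ 4 := by
  have hpp : p.Prime := Fact.out
  have hfin : Module.finrank (ZMod p) F = 4 * k := by
    have h := Module.card_eq_pow_finrank (K := ZMod p) (V := F)
    rw [hq, ZMod.card] at h
    exact (Nat.pow_right_injective hpp.two_le h).symm
  obtain ⟨f⟩ := FiniteField.nonempty_algHom_of_finrank_dvd (F := ZMod p) (K := GaloisField p k)
    (L := F) (by rw [GaloisField.finrank p hk, hfin]; exact dvd_mul_left k 4)
  obtain ⟨W, hW⟩ := exists_submodule_finrank_eq (ZMod p) (V := GaloisField p k) (r := r)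
    (by rwa [GaloisField.finrank p hk])
  have hinj : Function.Injective ((LinearMap.mulLeft (ZMod p) a).comp f.toLinearMap) :=
    (mul_right_injective₀ ha).comp f.injective
  refine ⟨W.map ((LinearMap.mulLeft (ZMod p) a).comp f.toLinearMap), ?_, ?_⟩
  · rw [← hW]
    exact (LinearEquiv.finrank_eq (Submodule.equivMapOfInjective _ hinj W)).symm
  · rintro _ ⟨w, -, rfl⟩ hb
    have hfw : f w ≠ 0 := by
      intro h
      apply hb
      simp [h]
    have hw : w ^ p ^ k = w := by
      have : Fintype (GaloisField p k) := Fintype.ofFinite _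
      rw [← GaloisField.card p k hk, Nat.card_eq_fintype_card, FiniteField.pow_card]
    obtain ⟨y, hy⟩ := exists_eq_pow_four_of_pow_eq_self hα he hp4 hq hfw (by rw [← map_pow, hw])
    refine ⟨y, ?_, by simp [← hy]⟩
    rintro rfl
    exact hfw (by rw [hy]; simp)

/-- The quotient is the sum of `m` powers of `p`, each `≡ 1 (mod 4)`. -/
theorem four_dvd_of_four_dvd_div {p m : ℕ} (hp : 2 ≤ p) (hp4 : p % 4 = 1)
    (h : 4 ∣ (p ^ m - 1) / (p - 1)) : 4 ∣ m := by
  rw [← Nat.geomSum_eq hp] at h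
  have h1 : ∑ i ∈ Finset.range m, p ^ i ≡ ∑ i ∈ Finset.range m, 1 [MOD 4] := by
    rw [Nat.ModEq, Finset.sum_nat_mod, Finset.sum_nat_mod _ _ fun _ => 1]
    simp [Nat.pow_mod, hp4]
  rw [h1.dvd_iff dvd_rfl] at h
  simpa using h

/-! ### Bounds for the weights and the final theorem. -/

section Weights

variable {p : ℕ} [Fact p.Prime] {F : Type*} [Field F] [Fintype F] [Algebra (ZMod p) F]
  {α θ : F} {e k N n₁ : ℕ} [NeZero e] (hα : IsPrimitiveRoot α (4 * e))
  (he : 4 * e + 1 = Fintype.card F) (hq : Fintype.card F = p ^ (4 * k))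
  (hNn : N * n₁ = 4 * e) (hN : N.gcd (4 * e / (p - 1)) = 4) (hθ : θ = α ^ N)

include hα he hq hNn hN hθ

theorem card_trace_ne_zero_ge {T : ℤ}
    (hT : ∀ a : F, a ≠ 0 → ∃ t : ℤ, quarticSum p a = t ∧ t ≤ T) (H : Submodule (ZMod p) F) :
    ((p : ℤ) ^ Module.finrank (ZMod p) H - 1) * ((p : ℤ) ^ (4 * k) - T) ≤
      N * p ^ Module.finrank (ZMod p) H *
        {i : Fin n₁ | ∃ a ∈ H, Algebra.trace (ZMod p) F (a * θ ^ (i : ℕ)) ≠ 0}.ncard := by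
  classical
  have : Fintype H := Fintype.ofFinite H
  have : NeZero (4 * e) := ⟨by have := NeZero.ne e; omega⟩
  have h := card_trace_ne_zero_eq_sum H hα he hq hNn hN hθ
  choose! t ht htT using hT
  have hne : ∀ a ∈ Finset.univ.erase (0 : H), (a : F) ≠ 0 := fun a ha h =>
    Finset.ne_of_mem_erase ha (Subtype.ext h)
  rw [Finset.sum_congr rfl fun a ha => by rw [ht a (hne a ha)], hq] at h
  have h' : (N : ℤ) * p ^ Module.finrank (ZMod p) H *
        {i : Fin n₁ | ∃ a ∈ H, Algebra.trace (ZMod p) F (a * θ ^ (i : ℕ)) ≠ 0}.ncard =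
      ∑ a ∈ Finset.univ.erase (0 : H), ((p : ℤ) ^ (4 * k) - t a) := by exact_mod_cast h
  have hcard : (((Finset.univ.erase (0 : H)).card : ℕ) : ℤ) =
      (p : ℤ) ^ Module.finrank (ZMod p) H - 1 := by
    rw [Finset.card_erase_of_mem (Finset.mem_univ _), Finset.card_univ,
      Nat.cast_sub Fintype.card_pos, Module.card_eq_pow_finrank (K := ZMod p), ZMod.card]
    push_cast
    rfl
  rw [h', ← hcard, ← nsmul_eq_mul]
  exact Finset.card_nsmul_le_sum _ _ _ fun a ha => sub_le_sub_left (htT a (hne a ha)) _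

theorem card_trace_ne_zero_eq {T : ℤ} (H : Submodule (ZMod p) F)
    (hT : ∀ a ∈ H, a ≠ 0 → quarticSum p a = T) :
    (N * p ^ Module.finrank (ZMod p) H *
        {i : Fin n₁ | ∃ a ∈ H, Algebra.trace (ZMod p) F (a * θ ^ (i : ℕ)) ≠ 0}.ncard : ℤ) =
    ((p : ℤ) ^ Module.finrank (ZMod p) H - 1) * ((p : ℤ) ^ (4 * k) - T) := by
  classical
  have : Fintype H := Fintype.ofFinite H
  have : NeZero (4 * e) := ⟨by have := NeZero.ne e; omega⟩
  have h := card_trace_ne_zero_eq_sum H hα he hq hNn hN hθ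
  rw [Finset.sum_congr rfl fun a ha => by
    rw [hT a a.2 fun h => Finset.ne_of_mem_erase ha (Subtype.ext h)], hq, Finset.sum_const,
    Finset.card_erase_of_mem (Finset.mem_univ _), Finset.card_univ, nsmul_eq_mul,
    Nat.cast_sub Fintype.card_pos, Module.card_eq_pow_finrank (K := ZMod p), ZMod.card] at h
  exact_mod_cast h

/-- A nonzero kernel element would span a line with empty support, against the lower bound, which is
positive as `T < q`. -/
theorem injective_trace_code {T : ℤ}
    (hT : ∀ a : F, a ≠ 0 → ∃ t : ℤ, quarticSum p a = t ∧ t ≤ T) (hTq : T < (p : ℤ) ^ (4 * k)) :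
    Function.Injective (LinearMap.pi fun i : Fin n₁ =>
      (Algebra.trace (ZMod p) F).comp (LinearMap.mulRight (ZMod p) (θ ^ (i : ℕ)))) := by
  rw [injective_iff_map_eq_zero]
  intro a ha
  by_contra ha0
  have h := card_trace_ne_zero_ge hα he hq hNn hN hθ hT (Submodule.span (ZMod p) {a})
  have hempty : {i : Fin n₁ | ∃ b ∈ Submodule.span (ZMod p) {a},
      Algebra.trace (ZMod p) F (b * θ ^ (i : ℕ)) ≠ 0} = ∅ := by
    refine Set.eq_empty_of_forall_notMem fun i => ?_
    rintro ⟨b, hb, hne⟩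
    obtain ⟨c, rfl⟩ := Submodule.mem_span_singleton.mp hb
    have h1 : Algebra.trace (ZMod p) F (a * θ ^ (i : ℕ)) = 0 := congrFun ha i
    rw [smul_mul_assoc, map_smul, h1, smul_zero] at hne
    exact hne rfl
  rw [hempty, finrank_span_singleton ha0, Set.ncard_empty, pow_one, Nat.cast_zero, mul_zero] at h
  have hp1 : (1 : ℤ) < p := by exact_mod_cast (Fact.out : p.Prime).one_lt
  have := mul_pos (sub_pos.mpr hp1) (sub_pos.mpr hTq)
  omega

end Weights

/-- Since `|2v| ≤ p^k`, the left side is at most `3 p^(2k)`, and `p^k > 3`. -/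
theorem IsQuarticRep.add_mul_abs_lt {p k : ℕ} (hp : 3 < p) (hk : k ≠ 0) {u v : ℤ}
    (h : IsQuarticRep p (4 * k) u v) :
    (p : ℤ) ^ (2 * k) + 4 * (p : ℤ) ^ k * |v| < (p : ℤ) ^ (4 * k) := by
  have h1 := h.1
  rw [show 4 * k / 2 = 2 * k by omega] at h1
  have hP : (3 : ℤ) < (p : ℤ) ^ k := by
    exact_mod_cast hp.trans_le (Nat.le_self_pow hk p)
  have hP2 : (p : ℤ) ^ (2 * k) = ((p : ℤ) ^ k) ^ 2 := by rw [mul_comm, pow_mul]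
  have hP4 : (p : ℤ) ^ (4 * k) = ((p : ℤ) ^ k) ^ 4 := by rw [mul_comm, pow_mul]
  rw [hP2] at h1 ⊢
  rw [hP4]
  generalize (p : ℤ) ^ k = P at *
  have hv : |2 * v| ≤ P := abs_le_of_sq_le_sq (by nlinarith [sq_nonneg u]) (by omega)
  rw [abs_mul, abs_two] at hv
  have h2 : P * (2 * |v|) ≤ P * P := mul_le_mul_of_nonneg_left hv (by omega)
  have h3 : P ^ 2 * 9 < P ^ 2 * P ^ 2 := mul_lt_mul_of_pos_left (by nlinarith) (by positivity)
  nlinarith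

theorem mainTheorem9 (p : ℕ) [Fact p.Prime] (hp : p ≡ 1 [MOD 4])
    (n₁ m q N : ℕ) (hn₁ : 0 < n₁) (hcop : n₁.Coprime p)
    (hm : IsLeast {k : ℕ | 0 < k ∧ p ^ k ≡ 1 [MOD n₁]} m)
    (hq : q = p ^ m) (hN : N = (q - 1) / n₁)
    (hN₁ : N.gcd ((q - 1) / (p - 1)) = 4)
    {F : Type*} [Field F] [Algebra (ZMod p) F] (hF : Nat.card F = q)
    (α : F) (hα : IsPrimitiveRoot α (q - 1)) (θ : F) (hθ : θ = α ^ N) :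
    (∃ u₁ v₁ : ℤ, IsQuarticRep p m u₁ v₁) ∧
    ∀ u₁ v₁ : ℤ, IsQuarticRep p m u₁ v₁ →
      ∀ r : ℕ, 1 ≤ r → 4 * r ≤ m →
        r ≤ Module.finrank (ZMod p) (traceCode p fun i : Fin n₁ => θ ^ (i : ℕ)) ∧
        (ghw (traceCode p fun i : Fin n₁ => θ ^ (i : ℕ)) r : ℝ) =
          (1 - 1 / (p : ℝ) ^ r) *
            (((q : ℝ) - √(q : ℝ) - 4 * (q : ℝ) ^ (1 / 4 : ℝ) * |(v₁ : ℝ)|) / (N : ℝ)) := by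
  have hpp : p.Prime := Fact.out
  have hp4 : p % 4 = 1 := hp
  have hp3 : 3 < p := by have := hpp.two_le; omega
  obtain ⟨⟨hm0, hmod⟩, -⟩ := hm
  obtain ⟨k, rfl⟩ : 4 ∣ m := four_dvd_of_four_dvd_div hpp.two_le hp4
    (by rw [← hq, ← hN₁]; exact Nat.gcd_dvd_right _ _)
  have hk : k ≠ 0 := by omega
  have hq1 : 1 < q := hq ▸ Nat.one_lt_pow hm0.ne' hpp.one_lt
  have hdvd : n₁ ∣ q - 1 := (Nat.modEq_iff_dvd' hq1.le).mp (hq ▸ hmod.symm)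
  have hNn : N * n₁ = q - 1 := by rw [hN, Nat.div_mul_cancel hdvd]
  obtain ⟨e, he⟩ : 4 ∣ q - 1 := hNn ▸ (hN₁ ▸ Nat.gcd_dvd_left N _ : 4 ∣ N).mul_right n₁
  have hN0 : N ≠ 0 := by rintro rfl; omega
  have : NeZero e := ⟨by rintro rfl; omega⟩
  have : Finite F := Nat.finite_of_card_ne_zero (by omega)
  have : Fintype F := Fintype.ofFinite F
  have hcard : Fintype.card F = p ^ (4 * k) := by rw [← Nat.card_eq_fintype_card, hF, hq]
  have he' : 4 * e + 1 = Fintype.card F := by rw [hcard, ← hq]; omega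
  rw [he] at hα hNn hN₁
  obtain ⟨u, v, huv, hmax, a, ha, haT⟩ :=
    exists_isQuarticRep_isMax_quarticSum hα he' hp4 hcard
  refine ⟨⟨u, v, huv⟩, fun u₁ v₁ hrep r hr1 hr => ?_⟩
  -- The maximum depends only on `|v|`, so it can be written with the given representation.
  rw [← hrep.abs_eq hpp hp4 huv] at hmax haT
  set T : ℤ := (p : ℤ) ^ (2 * k) + 4 * (p : ℤ) ^ k * |v₁| with hTdef
  have hinj := injective_trace_code hα he' hcard hNn hN₁ hθ hmax (hrep.add_mul_abs_lt hp3 hk)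
  obtain ⟨H, hHr, hH⟩ := exists_submodule_subset_mul_pow_four hα he' hp4 hcard ha
    (show r ≤ k by omega) hk
  -- The sum is constant on `a` times nonzero fourth powers, so `H` meets the lower bound with
  -- equality.
  have hHT := card_trace_ne_zero_eq hα he' hcard hNn hN₁ hθ (T := T) H fun b hb hb0 => by
    obtain ⟨d, hd, rfl⟩ := hH b hb hb0
    rw [quarticSum_mul_pow_four p a hd, haT]
  have hghw := ghw_range_eq _ hinj H fun H' hH' => by
    have h := card_trace_ne_zero_ge hα he' hcard hNn hN₁ hθ hmax H'
    rw [hH', ← hHT] at h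
    have hpos : (0 : ℤ) < N * p ^ Module.finrank (ZMod p) H := by
      have := hpp.pos
      positivity
    exact_mod_cast le_of_mul_le_mul_left h hpos
  rw [hHr] at hghw hHT
  constructor
  · rw [traceCode, LinearMap.finrank_range_of_inj hinj, ← hHr]
    exact Submodule.finrank_le H
  · have h1 : (ghw (traceCode p fun i : Fin n₁ => θ ^ (i : ℕ)) r : ℝ) =
        ({i : Fin n₁ | ∃ a ∈ H, Algebra.trace (ZMod p) F (a * θ ^ (i : ℕ)) ≠ 0}.ncard : ℝ) :=
      congrArg _ hghw
    have hp0 : (0 : ℝ) < p := by exact_mod_cast hpp.pos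
    have hsqrt : √(q : ℝ) = (p : ℝ) ^ (2 * k) := by
      rw [hq, Nat.cast_pow, show 4 * k = 2 * k * 2 by ring, pow_mul, Real.sqrt_sq (by positivity)]
    have hroot : (q : ℝ) ^ (1 / 4 : ℝ) = (p : ℝ) ^ k := by
      rw [hq, Nat.cast_pow, mul_comm, pow_mul, ← Real.rpow_natCast, ← Real.rpow_mul (by positivity)]
      norm_num
    have h2 : (N * (p : ℝ) ^ r *
        {i : Fin n₁ | ∃ a ∈ H, Algebra.trace (ZMod p) F (a * θ ^ (i : ℕ)) ≠ 0}.ncard) =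
        ((p : ℝ) ^ r - 1) * ((p : ℝ) ^ (4 * k) - (p ^ (2 * k) + 4 * p ^ k * |(v₁ : ℝ)|)) := by
      have := congrArg (Int.cast (R := ℝ)) hHT
      rw [hTdef] at this
      push_cast at this
      exact this
    have hN0' : (N : ℝ) ≠ 0 := Nat.cast_ne_zero.mpr hN0
    rw [h1, hsqrt, hroot, hq, Nat.cast_pow]
    field_simp
    linear_combination h2
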